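/- Let $L/\mathbb{Q}$ be a field extension of degree $3$, and let $p \neq 2,3$ be a prime number. Suppose that $L/\mathbb{Q}$ is ramified at $p$ and unramified at every prime number $q \neq p$ (no condition is imposed at the infinite place). Then $L/\mathbb{Q}$ is Galois if and only if $p$ is totally ramified in $L$, i.e. if and only if $p\,\mathcal{O}_L = \mathfrak{p}^3$ for some prime ideal $\mathfrak{p}$ of the ring of integers $\mathcal{O}_L$. -/

import Mathlib

open scoped NumberField

/-- The rational prime `p` is ramified in the number field `L`: some prime of `𝓞 L` above `p` is
ramified over `ℤ`. -/
def RamifiedAt (L : Type*) [Field L] [NumberField L] (p : ℕ) : Prop :=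
  ¬ Algebra.IsUnramifiedIn (𝓞 L) (Ideal.span {(p : ℤ)})

/-- The rational prime `p` is totally ramified in the number field `L`: `p 𝓞_L = 𝔭 ^ [L : ℚ]` for
some prime ideal `𝔭` of `𝓞 L`. -/
def TotallyRamifiedAt (L : Type*) [Field L] [NumberField L] (p : ℕ) : Prop :=
  ∃ 𝔭 : Ideal (𝓞 L), 𝔭.IsPrime ∧
    Ideal.map (algebraMap ℤ (𝓞 L)) (Ideal.span {(p : ℤ)}) = 𝔭 ^ Module.finrank ℚ L

/-! In a Galois cubic field all ramification indices over `p` agree and divide 3, so a ramified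
prime is totally ramified. Conversely, total ramification at `p ≠ 3` is tame, so `p` has exponent 2
in the discriminant; no other prime divides it, hence it is `±p ^ 2`. Stickelberger's congruence
excludes `-p ^ 2`, which is 3 mod 4, and a cubic field with square discriminant contains all
conjugates of a generator. -/

/-- Every element `x` of a cubic algebra is a root of `X ^ 3 - t X ^ 2 + s X - n`, where `t` is the
trace of `x` and the trace of `x ^ 2` is `t ^ 2 - 2 s`. -/
theorem Module.Basis.exists_cubic_eq_zero {R S : Type*} [CommRing R] [CommRing S] [Algebra R S]
    (b : Module.Basis (Fin 3) R S) (x : S) :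
    ∃ s n : R, Algebra.trace R S (x ^ 2) = Algebra.trace R S x ^ 2 - 2 * s ∧
      x ^ 3 = algebraMap R S (Algebra.trace R S x) * x ^ 2 - algebraMap R S s * x +
        algebraMap R S n := by
  set M := Algebra.leftMulMatrix b x with hM
  -- Cayley–Hamilton: `s` is the sum of the principal 2×2 minors.
  refine ⟨M 0 0 * M 1 1 - M 0 1 * M 1 0 + (M 0 0 * M 2 2 - M 0 2 * M 2 0) +
    (M 1 1 * M 2 2 - M 1 2 * M 2 1), M.det, ?_, ?_⟩
  · simp only [Algebra.trace_eq_matrix_trace b, pow_two, map_mul, ← hM, Matrix.trace_fin_three,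
      Matrix.mul_apply, Fin.sum_univ_three]
    ring
  · apply Algebra.leftMulMatrix_injective b
    simp only [Algebra.trace_eq_matrix_trace b, map_pow, map_mul, map_sub, map_add, ← hM,
      AlgHom.commutes, Matrix.trace_fin_three, Matrix.det_fin_three]
    ext i j
    fin_cases i <;> fin_cases j <;>
    · simp [pow_succ, Matrix.mul_apply, Fin.sum_univ_three, Matrix.algebraMap_matrix_apply]
      ring

/-- The discriminant of `1, x, x ^ 2` in a cubic algebra is the discriminant of a monic cubic
polynomial that has `x` as a root. -/
theorem Module.Basis.exists_cubic_eq_zero_and_discr {R S : Type*} [CommRing R] [CommRing S]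
    [Algebra R S] [Nontrivial R] (b : Module.Basis (Fin 3) R S) (x : S) :
    ∃ t s n : R, x ^ 3 = algebraMap R S t * x ^ 2 - algebraMap R S s * x + algebraMap R S n ∧
      Algebra.discr R ![1, x, x ^ 2] =
        t ^ 2 * s ^ 2 - 4 * s ^ 3 - 4 * t ^ 3 * n - 27 * n ^ 2 + 18 * t * s * n := by
  obtain ⟨s, n, h2, hx⟩ := b.exists_cubic_eq_zero x
  set t := Algebra.trace R S x with ht
  have h0 : Algebra.trace R S 1 = 3 := by
    rw [← map_one (algebraMap R S), Algebra.trace_algebraMap_of_basis b]; simp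
  have h3 : Algebra.trace R S (x ^ 3) = t * Algebra.trace R S (x ^ 2) - s * t + n * 3 := by
    have : x ^ 3 = t • x ^ 2 - s • x + n • (1 : S) := by
      rw [hx]; simp only [Algebra.smul_def, mul_one]
    rw [this]; simp [h0, ← ht]
  have h4 : Algebra.trace R S (x ^ 4) =
      t * Algebra.trace R S (x ^ 3) - s * Algebra.trace R S (x ^ 2) + n * t := by
    have : x ^ 4 = t • x ^ 3 - s • x ^ 2 + n • x := by
      simp only [Algebra.smul_def]
      linear_combination x * hx
    rw [this]; simp [← ht]
  refine ⟨t, s, n, hx, ?_⟩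
  have e1 : x * x = x ^ 2 := by ring
  have e2 : x * x ^ 2 = x ^ 3 := by ring
  have e3 : x ^ 2 * x = x ^ 3 := by ring
  have e4 : x ^ 2 * x ^ 2 = x ^ 4 := by ring
  simp [Algebra.discr_def, Matrix.det_fin_three, Algebra.traceMatrix_apply,
    Algebra.traceForm_apply, e1, e2, e3, e4, h0, ← ht]
  rw [h4, h3, h2]
  ring

/-- The discriminant of `1, x, y` in a cubic ring is a square modulo `4`. -/
theorem Module.Basis.exists_discr_one_eq_sq_add_four_mul {R S : Type*} [CommRing R] [CommRing S]
    [Algebra R S] [Nontrivial R] (b : Module.Basis (Fin 3) R S) (x y : S) :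
    ∃ u v : R, Algebra.discr R ![1, x, y] = u ^ 2 + 4 * v := by
  obtain ⟨s, -, hs, -⟩ := b.exists_cubic_eq_zero x
  obtain ⟨s', -, hs', -⟩ := b.exists_cubic_eq_zero y
  have h0 : Algebra.trace R S 1 = 3 := by
    rw [← map_one (algebraMap R S), Algebra.trace_algebraMap_of_basis b]; simp
  set t := Algebra.trace R S x with ht
  set t' := Algebra.trace R S y with ht'
  set B := Algebra.trace R S (x * y) with hB
  have e1 : x * x = x ^ 2 := by ring
  have e2 : y * y = y ^ 2 := by ring
  -- Modulo 4 the Gram determinant is `t²t'² + 2tt'B - 3B² ≡ (tt' + B)²`.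
  refine ⟨t * t' + B, -t ^ 2 * s' - t' ^ 2 * s + 3 * s * s' - B ^ 2, ?_⟩
  simp [Algebra.discr_def, Matrix.det_fin_three, Algebra.traceMatrix_apply,
    Algebra.traceForm_apply, e1, e2, mul_comm y x, h0, ← ht, ← ht', ← hB, hs, hs']
  ring

/-- **Stickelberger's theorem** for cubic fields: the discriminant is not `3` modulo `4`. -/
theorem NumberField.discr_emod_four_ne_three {L : Type*} [Field L] [NumberField L]
    (b : Module.Basis (Fin 3) ℤ (𝓞 L)) : NumberField.discr L % 4 ≠ 3 := by
  intro hd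
  -- Otherwise 2 would be a unit, but its norm is 8.
  have hone : ∃ i, ¬ 2 ∣ b.repr 1 i := by
    by_contra! h
    choose c hc using h
    have h2 : (1 : 𝓞 L) = 2 * ∑ i, c i • b i := by
      conv_lhs => rw [← b.sum_repr 1]
      rw [Finset.mul_sum]
      refine Finset.sum_congr rfl fun i _ ↦ ?_
      rw [hc i, zsmul_eq_mul, zsmul_eq_mul]; push_cast; ring
    have hu : IsUnit ((2 : ℤ) : 𝓞 L) := .of_mul_eq_one _ (by exact_mod_cast h2.symm)
    have hn := hu.map (Algebra.norm ℤ)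
    rw [← eq_intCast (algebraMap ℤ (𝓞 L)), Algebra.norm_algebraMap_of_basis b] at hn
    simp [Int.isUnit_iff] at hn
  obtain ⟨i, hi⟩ := hone
  -- Replacing `b i` by 1 multiplies the discriminant by the odd square `(b.repr 1 i) ^ 2`.
  have key : ∃ x y : 𝓞 L, ∃ P : Matrix (Fin 3) (Fin 3) ℤ, P.det ^ 2 = b.repr 1 i ^ 2 ∧
      ![1, x, y] = (P.map (algebraMap ℤ (𝓞 L))).mulVec b := by
    have h1 := b.sum_repr 1
    simp only [Fin.sum_univ_three, zsmul_eq_mul] at h1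
    fin_cases i
    · refine ⟨b 1, b 2, !![b.repr 1 0, b.repr 1 1, b.repr 1 2; 0, 1, 0; 0, 0, 1], ?_, ?_⟩
      · simp [Matrix.det_fin_three]
      · ext i; fin_cases i <;> simp [Matrix.mulVec, dotProduct, Fin.sum_univ_three, h1]
    · refine ⟨b 0, b 2, !![b.repr 1 0, b.repr 1 1, b.repr 1 2; 1, 0, 0; 0, 0, 1], ?_, ?_⟩
      · simp [Matrix.det_fin_three]
      · ext i; fin_cases i <;> simp [Matrix.mulVec, dotProduct, Fin.sum_univ_three, h1]
    · refine ⟨b 0, b 1, !![b.repr 1 0, b.repr 1 1, b.repr 1 2; 1, 0, 0; 0, 1, 0], ?_, ?_⟩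
      · simp [Matrix.det_fin_three]
      · ext i; fin_cases i <;> simp [Matrix.mulVec, dotProduct, Fin.sum_univ_three, h1]
  obtain ⟨x, y, P, hP, hxy⟩ := key
  obtain ⟨u, v, huv⟩ := b.exists_discr_one_eq_sq_add_four_mul x y
  rw [hxy, Algebra.discr_of_matrix_mulVec, hP, NumberField.discr_eq_discr] at huv
  generalize b.repr 1 i = c at *
  generalize NumberField.discr L = d at *
  have hc : c ^ 2 % 4 = 1 := by
    obtain ⟨k, rfl⟩ : Odd c := by rw [← Int.not_even_iff_odd, even_iff_two_dvd]; exact hi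
    ring_nf; omega
  have h4 : c ^ 2 * d % 4 = 3 := by rw [Int.mul_emod, hc, hd]; rfl
  rw [huv] at h4
  rcases Int.even_or_odd' u with ⟨k, rfl | rfl⟩ <;> ring_nf at h4 <;> omega

/-- A cubic number field whose discriminant is a square is Galois over `ℚ`. -/
theorem NumberField.isGalois_of_discr_eq_sq {L : Type*} [Field L] [NumberField L]
    (b : Module.Basis (Fin 3) ℤ (𝓞 L)) {m : ℤ} (hm : NumberField.discr L = m ^ 2) :
    IsGalois ℚ L := by
  have hdeg : Module.finrank ℚ L = 3 := by
    rw [← NumberField.RingOfIntegers.rank, Module.finrank_eq_card_basis b, Fintype.card_fin]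
  obtain ⟨θ, hθ⟩ := Field.exists_primitive_element ℚ L
  obtain ⟨α, k, hk, hα⟩ : ∃ α : 𝓞 L, ∃ k : ℤ, k ≠ 0 ∧ (α : L) = k * θ := by
    have halg : IsAlgebraic ℤ θ :=
      (IsFractionRing.isAlgebraic_iff ℤ ℚ L).mpr (Algebra.IsAlgebraic.isAlgebraic θ)
    obtain ⟨k, hk, hint⟩ := halg.exists_integral_multiple
    exact ⟨⟨k • θ, hint⟩, k, hk, zsmul_eq_mul _ _⟩
  have hgen : IntermediateField.adjoin ℚ {(α : L)} = ⊤ := by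
    rw [eq_top_iff, ← hθ, IntermediateField.adjoin_simple_le_iff]
    have h1 := IntermediateField.mem_adjoin_simple_self ℚ (α : L)
    have : θ = (k : L)⁻¹ * α := by
      rw [hα]; field_simp
    rw [this]
    exact mul_mem (inv_mem (intCast_mem _ k)) h1
  obtain ⟨t, s, n, hx, hD⟩ := b.exists_cubic_eq_zero_and_discr α
  obtain ⟨P, hP⟩ : ∃ P : Matrix (Fin 3) (Fin 3) ℤ,
      ![1, α, α ^ 2] = (P.map (algebraMap ℤ (𝓞 L))).mulVec b := by
    refine ⟨Matrix.of fun i ↦ b.repr (![1, α, α ^ 2] i), ?_⟩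
    ext i
    refine congrArg _ ((b.sum_repr (![1, α, α ^ 2] i)).symm.trans ?_)
    simp [Matrix.mulVec, dotProduct]
  rw [hP, Algebra.discr_of_matrix_mulVec, NumberField.discr_eq_discr, hm] at hD
  replace hx : (α : L) ^ 3 = t * (α : L) ^ 2 - s * (α : L) + n := by
    simpa using congrArg (algebraMap (𝓞 L) L) hx
  generalize P.det = e at hD
  replace hD := congrArg (Int.cast : ℤ → L) hD
  push_cast at hD
  set a : L := (α : L)
  have hder : 3 * a ^ 2 - 2 * t * a + s ≠ 0 := by
    intro h0
    have hdm := minpoly.degree_le_of_ne_zero ℚ a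
      (p := .C 3 * .X ^ 2 + .C (-2 * t : ℚ) * .X + .C (s : ℚ)) ?_ ?_
    · rw [Polynomial.degree_quadratic (by norm_num),
        Polynomial.degree_eq_natDegree (minpoly.ne_zero (Algebra.IsIntegral.isIntegral a)),
        (Field.primitive_element_iff_minpoly_natDegree_eq ℚ a).mp hgen, hdeg] at hdm
      norm_num at hdm
    · rw [← Polynomial.degree_ne_bot, Polynomial.degree_quadratic (by norm_num)]
      decide
    · simp; linear_combination h0
  -- If `β`, `γ` are the other roots, `(a - β)(a - γ)(β - γ)` is a square root `±e * m` of the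
  -- discriminant, and its first two factors give the derivative at `a`. So `δ` is `±(β - γ)`, while
  -- `β + γ = t - a`.
  set δ : L := e * m / (3 * a ^ 2 - 2 * t * a + s) with hδ
  have hδ2 : δ ^ 2 = -3 * a ^ 2 + 2 * t * a + t ^ 2 - 4 * s := by
    rw [hδ, div_pow, div_eq_iff (pow_ne_zero 2 hder), mul_pow, hD,
      show (n : L) = a ^ 3 - t * a ^ 2 + s * a by linear_combination -hx]
    ring
  set β : L := (t - a + δ) / 2 with hβ
  set γ : L := (t - a - δ) / 2 with hγ
  let f : Polynomial ℚ := .X ^ 3 - .C (t : ℚ) * .X ^ 2 + .C (s : ℚ) * .X - .C (n : ℚ)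
  have hf : f.map (algebraMap ℚ L) = (.X - .C a) * (.X - .C β) * (.X - .C γ) := by
    have e1 : (t : L) = a + β + γ := by rw [hβ, hγ]; ring
    have e2 : (s : L) = a * β + a * γ + β * γ := by
      rw [hβ, hγ]; linear_combination (1 / 4) * hδ2
    have e3 : (n : L) = a * β * γ := by
      rw [hβ, hγ]; linear_combination (a / 4) * hδ2 - hx
    have hcast (z : ℤ) : algebraMap ℚ L z = z := map_intCast _ z
    simp only [f, Polynomial.map_sub, Polynomial.map_add, Polynomial.map_mul, Polynomial.map_pow,
      Polynomial.map_X, Polynomial.map_C, hcast, e1, e2, e3, map_add, map_mul]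
    ring
  have hf0 : f.map (algebraMap ℚ L) ≠ 0 := by
    rw [hf]
    exact mul_ne_zero (mul_ne_zero (Polynomial.X_sub_C_ne_zero _) (Polynomial.X_sub_C_ne_zero _))
      (Polynomial.X_sub_C_ne_zero _)
  have : f.IsSplittingField ℚ L := by
    rw [isSplittingField_iff_intermediateField]
    refine ⟨?_, ?_⟩
    · rw [hf]
      exact ((Polynomial.Splits.X_sub_C _).mul (.X_sub_C _)).mul (.X_sub_C _)
    · rw [eq_top_iff, ← hgen]
      refine IntermediateField.adjoin.mono _ _ _ ?_
      rw [Set.singleton_subset_iff, Polynomial.mem_rootSet']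
      refine ⟨hf0, ?_⟩
      rw [Polynomial.aeval_def, ← Polynomial.eval_map, hf]
      simp
  have : Normal ℚ L := Normal.of_isSplittingField f
  exact {}

theorem NumberField.natCast_dvd_discr_iff_ramifiedAt (L : Type*) [Field L] [NumberField L] {q : ℕ}
    (hq : q.Prime) : (q : ℤ) ∣ NumberField.discr L ↔ RamifiedAt L q := by
  rw [RamifiedAt, ← NumberField.not_dvd_discr_iff_isUnramifiedIn L (𝓞 L)
    (Nat.prime_iff_prime_int.mp hq), not_not]

/-- A ramified prime in a Galois number field of prime degree is totally ramified. -/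
theorem RamifiedAt.totallyRamifiedAt (L : Type*) [Field L] [NumberField L] [IsGalois ℚ L]
    (hdeg : (Module.finrank ℚ L).Prime) {p : ℕ} (hp : p.Prime) (hram : RamifiedAt L p) :
    TotallyRamifiedAt L p := by
  have hp0 : Ideal.span {(p : ℤ)} ≠ ⊥ := by simpa using hp.ne_zero
  have hpp : (Ideal.span {(p : ℤ)}).IsPrime := by
    rw [Ideal.span_singleton_prime (by exact_mod_cast hp.ne_zero)]
    exact Nat.prime_iff_prime_int.mp hp
  have hpm : (Ideal.span {(p : ℤ)}).IsMaximal := hpp.isMaximal hp0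
  rw [RamifiedAt, Algebra.isUnramifiedIn_iff_forall_ramificationIdx_eq_one] at hram
  push Not at hram
  obtain ⟨P, hP, hPp, he⟩ := hram
  have hcard := Ideal.ncard_primesOver_mul_ramificationIdxIn_mul_inertiaDegIn
    (Ideal.span {(p : ℤ)}) (𝓞 L) Gal(L/ℚ)
  rw [IsGaloisGroup.card_eq_finrank Gal(L/ℚ) ℚ L,
    Ideal.ramificationIdxIn_eq_ramificationIdx (Ideal.span {(p : ℤ)}) P Gal(L/ℚ)] at hcard
  have he' : P.ramificationIdx ℤ = Module.finrank ℚ L :=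
    ((Nat.dvd_prime hdeg).mp ⟨_, hcard.symm.trans (mul_left_comm _ _ _)⟩).resolve_left he
  have hone : ((Ideal.span {(p : ℤ)}).primesOver (𝓞 L)).ncard = 1 := by
    rw [he', mul_left_comm] at hcard
    exact Nat.eq_one_of_mul_eq_one_right
      (Nat.eq_of_mul_eq_mul_left hdeg.pos (hcard.trans (mul_one _).symm))
  obtain ⟨Q, hQ⟩ := Set.ncard_eq_one.mp hone
  obtain rfl : P = Q := by
    have : P ∈ (Ideal.span {(p : ℤ)}).primesOver (𝓞 L) := ⟨hP, hPp⟩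
    rwa [hQ] at this
  refine ⟨P, hP, ?_⟩
  rw [Ideal.map_algebraMap_eq_finsetProd_pow hp0, ← he']
  simp [hQ]

/-- If `p` is totally and tamely ramified in a number field of degree `n`, then the exponent of `p`
in the discriminant is `n - 1`. -/
theorem TotallyRamifiedAt.natAbs_discr_eq (L : Type*) [Field L] [NumberField L] {p : ℕ}
    (hp : p.Prime) (hpn : ¬ p ∣ Module.finrank ℚ L) (htot : TotallyRamifiedAt L p)
    (hunram : ∀ q : ℕ, q.Prime → q ≠ p → ¬ RamifiedAt L q) :
    (NumberField.discr L).natAbs = p ^ (Module.finrank ℚ L - 1) := by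
  obtain ⟨P, hP, hmap⟩ := htot
  set n := Module.finrank ℚ L with hn
  have hn0 : n ≠ 0 := Module.finrank_pos.ne'
  have hp0 : Ideal.span {(p : ℤ)} ≠ ⊥ := by simpa using hp.ne_zero
  have hpp : (Ideal.span {(p : ℤ)}).IsPrime := by
    rw [Ideal.span_singleton_prime (by exact_mod_cast hp.ne_zero)]
    exact Nat.prime_iff_prime_int.mp hp
  have hpm : (Ideal.span {(p : ℤ)}).IsMaximal := hpp.isMaximal hp0
  have hmap' : Ideal.span {(p : 𝓞 L)} = P ^ n := by
    rw [← hmap, Ideal.map_span]; simp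
  have hnorm : Ideal.absNorm P = p := by
    have h := congrArg Ideal.absNorm hmap'
    rw [map_pow, Ideal.absNorm_span_natCast, NumberField.RingOfIntegers.rank] at h
    exact (Nat.pow_left_injective hn0 h).symm
  obtain ⟨J, hJ⟩ := pow_sub_one_dvd_differentIdeal ℤ P n hp0 (dvd_of_eq hmap.symm)
  -- Tameness: if `P ^ n = (p)` divided the different, the trace `n / p` of `1 / p` would be an
  -- integer.
  have hnot : ¬ P ∣ J := by
    rintro ⟨J', rfl⟩
    have hle : differentIdeal ℤ (𝓞 L) ≤ Ideal.span {(p : 𝓞 L)} := by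
      rw [← Ideal.dvd_iff_le, hmap', hJ, ← mul_assoc, ← pow_succ, Nat.sub_add_cancel (by omega)]
      exact dvd_mul_right _ _
    have hpL : (p : 𝓞 L) ≠ 0 := by exact_mod_cast hp.ne_zero
    rw [differentialIdeal_le_iff (K := ℚ) (L := L) (by simpa using hpL)] at hle
    have hmem : algebraMap ℚ L (p : ℚ)⁻¹ ∈
        ((Ideal.span {(p : 𝓞 L)} : FractionalIdeal (nonZeroDivisors (𝓞 L)) L)⁻¹ :) := by
      rw [FractionalIdeal.coeIdeal_span_singleton, FractionalIdeal.spanSingleton_inv]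
      simpa using FractionalIdeal.mem_spanSingleton_self (nonZeroDivisors (𝓞 L)) (p : L)⁻¹
    have h1 := hle ⟨_, hmem, rfl⟩
    rw [Submodule.mem_one] at h1
    obtain ⟨m, hm⟩ := h1
    have hm' : (m : ℚ) = n * (p : ℚ)⁻¹ := by
      have h := hm.trans (Algebra.trace_algebraMap (p : ℚ)⁻¹)
      simpa [← hn] using h
    rw [eq_mul_inv_iff_mul_eq₀ (by exact_mod_cast hp.ne_zero)] at hm'
    exact hpn (Int.natCast_dvd_natCast.mp ⟨m, by rw [mul_comm]; exact_mod_cast hm'.symm⟩)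
  -- A prime factor of `J` divides the different, so it lies over `p` and must be `P`.
  have hJ1 : J = 1 := by
    by_contra hJ1
    obtain ⟨q, hq, hqJ⟩ := Nat.exists_prime_and_dvd (n := Ideal.absNorm J)
      (by rwa [Ne, Ideal.absNorm_eq_one_iff, ← Ideal.one_eq_top])
    obtain ⟨M, hM, hMq, hMJ⟩ := Ideal.exists_isMaximal_dvd_of_dvd_absNorm' hq J hqJ
    have hqM : (q : 𝓞 L) ∈ M := by
      have : (q : ℤ) ∈ M.under ℤ := hMq ▸ Ideal.mem_span_singleton_self _
      simpa using this
    have hMD : M ∣ differentIdeal ℤ (𝓞 L) := hJ ▸ hMJ.mul_left _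
    rw [dvd_differentIdeal_iff] at hMD
    have hqp : q = p := by
      by_contra hne
      apply hunram q hq hne
      rw [← NumberField.natCast_dvd_discr_iff_ramifiedAt L hq]
      by_contra hd
      rw [NumberField.not_dvd_discr_iff_forall_mem L (𝓞 L) (Nat.prime_iff_prime_int.mp hq)] at hd
      exact hMD (hd M hM.isPrime (by simpa using hqM))
    subst hqp
    have hPM : P ≤ M := by
      refine hM.isPrime.le_of_pow_le (n := n) ?_
      rw [← hmap']; simpa [Ideal.span_le] using hqM
    have hPmax : P.IsMaximal := hP.isMaximal (by
      rintro rfl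
      simp at hnorm; exact hq.ne_zero hnorm.symm)
    rw [hPmax.eq_of_le hM.ne_top hPM] at hnot
    exact hnot hMJ
  rw [← NumberField.absNorm_differentIdeal L (𝓞 L), hJ, hJ1, mul_one, map_pow, hnorm]

theorem lemma3p2 (L : Type*) [Field L] [NumberField L] (hdeg : Module.finrank ℚ L = 3)
    (p : ℕ) (hp : p.Prime) (hp2 : p ≠ 2) (hp3 : p ≠ 3)
    (hram : RamifiedAt L p)
    (hunram : ∀ q : ℕ, q.Prime → q ≠ p → ¬ RamifiedAt L q) :
    IsGalois ℚ L ↔ TotallyRamifiedAt L p := by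
  refine ⟨fun _ ↦ hram.totallyRamifiedAt L (hdeg ▸ Nat.prime_three) hp, fun htot ↦ ?_⟩
  have hdisc := htot.natAbs_discr_eq L hp
    (by rwa [hdeg, Nat.prime_dvd_prime_iff_eq hp Nat.prime_three]) hunram
  rw [hdeg] at hdisc
  let b : Module.Basis (Fin 3) ℤ (𝓞 L) :=
    Module.finBasisOfFinrankEq ℤ (𝓞 L) (by rw [NumberField.RingOfIntegers.rank, hdeg])
  refine NumberField.isGalois_of_discr_eq_sq b (m := p) ?_
  rcases Int.natAbs_eq (NumberField.discr L) with h | h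
  · rw [h, hdisc]; norm_num
  · refine absurd ?_ (NumberField.discr_emod_four_ne_three b)
    rw [h, hdisc]
    obtain ⟨k, rfl⟩ := hp.odd_of_ne_two hp2
    push_cast; ring_nf; omega
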